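/- Fix a set $V$ of propositional variables. Formulas of Łukasiewicz logic Ł are built from $V$ with $\neg$ and $\rightarrow$; formulas of $\mathcal{R}$Ł (respectively, of Rational Łukasiewicz logic $\mathcal{Q}$Ł) are built using in addition a unary connective $\nabla_r$ for each $r\in[0,1]$ (respectively, each $r\in[0,1]\cap\mathbb{Q}$). Put $\varphi\vee\psi=(\varphi\rightarrow\psi)\rightarrow\psi$, $\varphi\oplus\psi=\neg\varphi\rightarrow\psi$, $\varphi\odot\psi=\neg(\neg\varphi\oplus\neg\psi)$, $\varphi\leftrightarrow\psi=(\varphi\rightarrow\psi)\odot(\psi\rightarrow\varphi)$ and $\Delta_r\varphi=\neg\nabla_r\neg\varphi$. The axioms of $\mathcal{R}$Ł (respectively, $\mathcal{Q}$Ł) are, for all formulas $\varphi,\psi,\chi$ and all admissible scalars $r,q$: $\varphi\rightarrow(\psi\rightarrow\varphi)$; $(\varphi\rightarrow\psi)\rightarrow((\psi\rightarrow\chi)\rightarrow(\varphi\rightarrow\chi))$; $(\varphi\vee\psi)\rightarrow(\psi\vee\varphi)$; $(\neg\psi\rightarrow\neg\varphi)\rightarrow(\varphi\rightarrow\psi)$;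 $\nabla_r(\varphi\rightarrow\psi)\leftrightarrow(\nabla_r\varphi\rightarrow\nabla_r\psi)$; $\nabla_{\max(0,r-q)}\varphi\leftrightarrow(\nabla_q\varphi\rightarrow\nabla_r\varphi)$; $\nabla_r\nabla_q\varphi\leftrightarrow\nabla_{rq}\varphi$; $\nabla_1\varphi\leftrightarrow\varphi$. The only rule is modus ponens. For a logic $\mathcal{L}\in\{\mathcal{Q}\text{Ł},\mathcal{R}\text{Ł}\}$ and a set $\Theta$ of its formulas let $Thm(\Theta,\mathcal{L})=\{\varphi\mid\Theta\vdash_{\mathcal{L}}\varphi\}$; we write $Thm(\varphi,\mathcal{L})$ for $Thm(\{\varphi\},\mathcal{L})$. A theory of $\mathcal{L}$ is a set of the form $Thm(\Theta,\mathcal{L})$, and it is Ł-generated if $\Theta$ can be chosen to consist of formulas of Ł. Then: (1) For every formula $\varphi$ of $\mathcal{Q}$Ł there is a formula $\beta$ of Ł with $Thm(\varphi,\mathcal{Q}\text{Ł})=Thm(\beta,\mathcal{Q}\text{Ł})$. (2) Every theory of $\mathcal{Q}$Ł is Ł-generated. (3) This fails in $\mathcal{R}$Ł: for every variable $v\in V$,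 the theory $Thm\big(\Delta_{\sqrt2/2}v\oplus\Delta_{\sqrt2/2}v,\ \mathcal{R}\text{Ł}\big)$ of $\mathcal{R}$Ł is not Ł-generated. In particular, there is no formula $\beta$ of Ł with $Thm\big(\Delta_{\sqrt2/2}v\oplus\Delta_{\sqrt2/2}v,\ \mathcal{R}\text{Ł}\big)=Thm(\beta,\mathcal{R}\text{Ł})$. -/

import Mathlib

/-- Formulas of plain Łukasiewicz logic over the set `V` of propositional variables:
the basic connectives are negation and implication. -/
inductive LukForm (V : Type*) : Type _
  | var (v : V) : LukForm V
  | neg (φ : LukForm V) : LukForm V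
  | imp (φ ψ : LukForm V) : LukForm V

/-- Formulas of Łukasiewicz logic enriched with one unary connective `∇_r` for every scalar `r`
in the unit interval of the ordered field `K`. -/
inductive ScalarForm (K : Type*) [Field K] [LinearOrder K] [IsStrictOrderedRing K]
    (V : Type*) : Type _
  | var (v : V) : ScalarForm K V
  | neg (φ : ScalarForm K V) : ScalarForm K V
  | imp (φ ψ : ScalarForm K V) : ScalarForm K V
  | nabla (r : Set.Icc (0 : K) 1) (φ : ScalarForm K V) : ScalarForm K V

/-- Formulas of Rational Łukasiewicz logic: scalars in `[0,1] ∩ ℚ`. -/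
abbrev RatLukForm (V : Type*) := ScalarForm ℚ V

/-- Formulas of the logic of Riesz MV-algebras: scalars in the real interval `[0,1]`. -/
abbrev RieszLukForm (V : Type*) := ScalarForm ℝ V

/-- `r ⊙ q* = max(0, r - q)` in the standard MV-algebra structure on the unit interval of `K`. -/
def scalarMinus {K : Type*} [Field K] [LinearOrder K] [IsStrictOrderedRing K]
    (r q : Set.Icc (0 : K) 1) : Set.Icc (0 : K) 1 :=
  ⟨max 0 ((r : K) - (q : K)), le_max_left _ _,
    max_le zero_le_one ((sub_le_self _ q.2.1).trans r.2.2)⟩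

namespace ScalarForm

variable {K : Type*} [Field K] [LinearOrder K] [IsStrictOrderedRing K] {V : Type*}

/-- `φ ∨ ψ`. -/
def or (φ ψ : ScalarForm K V) : ScalarForm K V := imp (imp φ ψ) ψ

/-- The strong disjunction `φ ⊕ ψ`. -/
def oplus (φ ψ : ScalarForm K V) : ScalarForm K V := imp (neg φ) ψ

/-- The strong conjunction `φ ⊙ ψ`. -/
def odot (φ ψ : ScalarForm K V) : ScalarForm K V := neg (oplus (neg φ) (neg ψ))

/-- `φ ↔ ψ`. -/
def iff (φ ψ : ScalarForm K V) : ScalarForm K V := odot (imp φ ψ) (imp ψ φ)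

/-- The dual connective `Δ_r φ = ¬ ∇_r ¬ φ`, interpreted as multiplication by `r`. -/
def delta (r : Set.Icc (0 : K) 1) (φ : ScalarForm K V) : ScalarForm K V :=
  neg (nabla r (neg φ))

/-- The axioms: those of Łukasiewicz logic (for all formulas of the enriched language), and those
on the connectives `∇_r`. -/
inductive IsAxiom : ScalarForm K V → Prop
  | l1 (φ ψ : ScalarForm K V) : IsAxiom (imp φ (imp ψ φ))
  | l2 (φ ψ χ : ScalarForm K V) : IsAxiom (imp (imp φ ψ) (imp (imp ψ χ) (imp φ χ)))
  | l3 (φ ψ : ScalarForm K V) : IsAxiom (imp (or φ ψ) (or ψ φ))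
  | l4 (φ ψ : ScalarForm K V) : IsAxiom (imp (imp (neg ψ) (neg φ)) (imp φ ψ))
  | r1 (r : Set.Icc (0 : K) 1) (φ ψ : ScalarForm K V) :
      IsAxiom (iff (nabla r (imp φ ψ)) (imp (nabla r φ) (nabla r ψ)))
  | r2 (r q : Set.Icc (0 : K) 1) (φ : ScalarForm K V) :
      IsAxiom (iff (nabla (scalarMinus r q) φ) (imp (nabla q φ) (nabla r φ)))
  | r3 (r q : Set.Icc (0 : K) 1) (φ : ScalarForm K V) :
      IsAxiom (iff (nabla r (nabla q φ)) (nabla (r * q) φ))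
  | r4 (φ : ScalarForm K V) : IsAxiom (iff (nabla 1 φ) φ)

/-- `Θ ⊢ φ`: the only deduction rule is modus ponens. -/
inductive Derives (Θ : Set (ScalarForm K V)) : ScalarForm K V → Prop
  | ax {φ : ScalarForm K V} (h : IsAxiom φ) : Derives Θ φ
  | hyp {φ : ScalarForm K V} (h : φ ∈ Θ) : Derives Θ φ
  | mp {φ ψ : ScalarForm K V} (h₁ : Derives Θ φ) (h₂ : Derives Θ (imp φ ψ)) : Derives Θ ψ

/-- The theory determined by a set of formulas. -/
def Thm (Θ : Set (ScalarForm K V)) : Set (ScalarForm K V) := {φ | Derives Θ φ}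

/-- A theory is the set of consequences of some set of formulas. -/
def IsTheory (T : Set (ScalarForm K V)) : Prop := ∃ Θ : Set (ScalarForm K V), T = Thm Θ

end ScalarForm

/-- A formula of plain Łukasiewicz logic, read in the enriched language. -/
def LukForm.toScalar (K : Type*) [Field K] [LinearOrder K] [IsStrictOrderedRing K] {V : Type*} :
    LukForm V → ScalarForm K V
  | .var v => .var v
  | .neg φ => .neg (φ.toScalar K)
  | .imp φ ψ => .imp (φ.toScalar K) (ψ.toScalar K)

/-- A set of formulas of the enriched logic is Ł-generated if it is the theory determined, in the
enriched logic, by a set of formulas of plain Łukasiewicz logic. -/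
def ScalarForm.IsLukGenerated {K : Type*} [Field K] [LinearOrder K] [IsStrictOrderedRing K]
    {V : Type*} (T : Set (ScalarForm K V)) : Prop :=
  ∃ Θ : Set (LukForm V), T = ScalarForm.Thm (LukForm.toScalar K '' Θ)

/-- The scalar `√2 / 2`. -/
noncomputable def sqrtTwoDivTwo : Set.Icc (0 : ℝ) 1 :=
  ⟨Real.sqrt 2 / 2, by positivity, by
    have h : Real.sqrt 2 ≤ 2 := Real.sqrt_le_iff.2 ⟨by norm_num, by norm_num⟩
    linarith⟩

/-- The formula `Δ_{√2/2} v ⊕ Δ_{√2/2} v`. -/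
noncomputable def irrationalExample {V : Type*} (v : V) : RieszLukForm V :=
  .oplus (.delta sqrtTwoDivTwo (.var v)) (.delta sqrtTwoDivTwo (.var v))

/-! ### Clamping in abelian lattice-ordered groups -/

namespace LatticeGroup

variable {G : Type*} [AddCommGroup G] [Lattice G] [IsOrderedAddMonoid G]

/-! Positive half. The Lindenbaum algebra of the enriched logic contains multiplication by `1/2`,
and this alone embeds it as the unit interval `[0, u]` of an abelian lattice-ordered group: `half x
⊕ half y` is a midpoint that never overflows, and inverting the halving map produces sums
(`MidpointLattice.Envelope`, `toEnvelope_imp`). Call `u - value φ` the deficit of `φ`. A modus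
ponens with `φ` subtracts one deficit of `φ`, so `φ ⊢ ψ` as soon as the deficit of `ψ` is at most a
multiple of that of `φ` (`derives_of_le_nsmul`).

Let `S` be the set of values of Ł-formulas and `H` the subgroup it generates. Clearing denominators,
some `N ≥ 1` puts `N • value φ` in `H` (`exists_nsmul_value_mem`). Truncating an element of `H` to
`[0, u]` lands back in `S` (`IsMVClosed.clamp_mem`). With `x` the deficit of `φ`, the element `N • x
⊓ u` is therefore the deficit of some Ł-formula `β`, and `x ≤ N • x ⊓ u ≤ N • x` makes `φ` and `β`
interderivable. Replacing generators one at a time settles arbitrary theories.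

Negative half. On constant valuations an Ł-formula is, near an irrational point, affine with integer
coefficients; if it equals `1` there, it equals `1` on a neighbourhood. The example evaluates to
`min 1 (√2 x)`, which is `1` at `√2/2` but at no smaller `x`. Derivations use finitely many
premises, so soundness on a neighbourhood filter excludes even infinite sets of Ł-generators. -/

lemma inf_add_eq_zero {a b c : G} (ha : 0 ≤ a) (hb : 0 ≤ b) (hc : 0 ≤ c)
    (hab : a ⊓ b = 0) (hac : a ⊓ c = 0) : a ⊓ (b + c) = 0 := by
  refine le_antisymm ?_ (le_inf ha (add_nonneg hb hc))
  have h1 : a ⊓ (b + c) - c ≤ a ⊓ b :=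
    le_inf ((sub_le_self _ hc).trans inf_le_left) (sub_le_iff_le_add.2 inf_le_right)
  rw [hab, sub_nonpos] at h1
  exact hac ▸ le_inf inf_le_left h1

lemma inf_nsmul_eq_zero {a b : G} (ha : 0 ≤ a) (hb : 0 ≤ b) (hab : a ⊓ b = 0) (n : ℕ) :
    a ⊓ n • b = 0 := by
  induction n with
  | zero => simpa using ha
  | succ n ih =>
    rw [succ_nsmul]
    exact inf_add_eq_zero ha (nsmul_nonneg hb n) hb ih hab

lemma posPart_sub_of_inf_eq_zero {p q : G} (h : p ⊓ q = 0) : (p - q) ⊔ 0 = p := by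
  have h2 := inf_add_sup p q
  rw [h, zero_add] at h2
  have h3 : (p - q) ⊔ 0 = (p ⊔ q) - q := by rw [sup_sub, sub_self]
  rw [h3, h2, add_sub_cancel_right]

/-- Multiples of the disjoint elements `x⁺` and `x⁻` stay disjoint, so `n • x⁺ - n • x⁻` is already
the decomposition of `n • x` into positive and negative parts. -/
lemma nsmul_sup_zero (n : ℕ) (x : G) : n • (x ⊔ 0) = (n • x) ⊔ 0 := by
  have h0 : (x ⊔ 0) ⊓ (-x ⊔ 0) = 0 := posPart_inf_negPart_eq_zero x
  have hx : x = (x ⊔ 0) - (-x ⊔ 0) := (posPart_sub_negPart x).symm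
  have h1 := inf_nsmul_eq_zero le_sup_right le_sup_right h0 n
  have h2 := inf_nsmul_eq_zero (nsmul_nonneg le_sup_right n) le_sup_right
    ((inf_comm _ _).trans (inf_nsmul_eq_zero le_sup_right le_sup_right
      ((inf_comm _ _).trans h0) n)) n
  conv_rhs => rw [hx, nsmul_sub]
  exact (posPart_sub_of_inf_eq_zero h2).symm

lemma nsmul_inf_zero (n : ℕ) (x : G) : n • (x ⊓ 0) = (n • x) ⊓ 0 := by
  have h := nsmul_sup_zero n (-x)
  have h1 : ∀ y : G, y ⊓ 0 = -(-y ⊔ 0) := fun y => by rw [neg_sup]; simp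
  rw [h1, h1, smul_neg, h, smul_neg]

lemma nsmul_inf (n : ℕ) (x y : G) : n • (x ⊓ y) = n • x ⊓ n • y := by
  have h := nsmul_inf_zero n (x - y)
  have key : ∀ a b : G, (a - b) ⊓ 0 = a ⊓ b - b := fun a b => by rw [inf_sub, sub_self]
  rw [nsmul_sub, key, key, nsmul_sub] at h
  exact sub_left_injective h

/-- Truncation of `h` to the interval `[0, u]`. -/
def clamp (u h : G) : G := (h ⊓ u) ⊔ 0

omit [IsOrderedAddMonoid G] in
lemma clamp_of_nonneg {u h : G} (hu : 0 ≤ u) (hh : 0 ≤ h) : clamp u h = h ⊓ u :=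
  sup_eq_left.2 (le_inf hh hu)

omit [IsOrderedAddMonoid G] in
lemma clamp_of_nonpos {u h : G} (hh : h ≤ 0) : clamp u h = 0 :=
  sup_eq_right.2 (inf_le_left.trans hh)

omit [IsOrderedAddMonoid G] in
lemma clamp_of_le {u h : G} (hu : 0 ≤ u) (hh : u ≤ h) : clamp u h = u := by
  rw [clamp_of_nonneg hu (hu.trans hh), inf_eq_right.2 hh]

lemma clamp_eq_inf {u : G} (hu : 0 ≤ u) (h : G) : clamp u h = (h ⊔ 0) ⊓ u := by
  let _ := AddCommGroup.toDistribLattice G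
  rw [clamp, sup_inf_right, sup_eq_left.2 hu]

/-- Slicing `h⁺` into layers of thickness `u`: the layer between `n • u` and `(n + 1) • u` is a
truncation of a translate of `h`. -/
lemma inf_succ_nsmul {u : G} (hu : 0 ≤ u) (h : G) (n : ℕ) :
    (h ⊔ 0) ⊓ (n + 1) • u = (h ⊔ 0) ⊓ n • u + clamp u (h - n • u) := by
  have hle : n • u ≤ (n + 1) • u := nsmul_le_nsmul_left hu (Nat.le_succ n)
  set y := (h ⊔ 0) ⊓ (n + 1) • u with hy
  have h1 : (h ⊔ 0) ⊓ n • u = y ⊓ n • u := by rw [hy, inf_assoc, inf_eq_right.2 hle]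
  have h2 : y - y ⊓ n • u = (y - n • u) ⊔ 0 := by rw [sub_inf, sub_self, sup_comm]
  have h3 : y - n • u = (h ⊔ 0 - n • u) ⊓ u := by
    rw [hy, inf_sub, succ_nsmul, add_sub_cancel_left]
  have h4 : (h ⊔ 0 - n • u) ⊔ 0 = (h - n • u) ⊔ 0 := by
    rw [sup_sub, zero_sub, sup_assoc, sup_eq_right.2 (neg_nonpos.2 (nsmul_nonneg hu n))]
  have h5 : ((h ⊔ 0 - n • u) ⊓ u) ⊔ 0 = clamp u (h - n • u) := by
    change clamp u (h ⊔ 0 - n • u) = _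
    rw [clamp_eq_inf hu, h4, clamp_eq_inf hu]
  rw [h1, ← h5, ← h3, ← h2]
  abel

lemma inf_nsmul_eq_sum_clamp {u : G} (hu : 0 ≤ u) (h : G) (n : ℕ) :
    (h ⊔ 0) ⊓ n • u = ∑ k ∈ Finset.range n, clamp u (h - k • u) := by
  induction n with
  | zero => simp
  | succ n ih => rw [inf_succ_nsmul hu, Finset.sum_range_succ, ih]

/-- The recursion which computes the truncation of a sum. -/
lemma clamp_add {u b : G} (hb : 0 ≤ b) (hbu : b ≤ u) (h : G) :
    clamp u (h + b) = (((clamp u h + b) ⊓ u) + clamp u (h + u) - u) ⊔ 0 := by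
  let _ := AddCommGroup.toDistribLattice G
  have hu := hb.trans hbu
  -- The first two layers of `h + u` are `clamp u (h + u)` and `clamp u h`. Their sum minus `u` is
  -- `h` truncated to `[-u, u]`, which leaves room to add `b`.
  have h1 := inf_succ_nsmul hu (h + u) 1
  have h1' : ((h + u) ⊔ 0) ⊓ 1 • u = clamp u (h + u) := by rw [clamp_eq_inf hu, one_nsmul]
  rw [h1', one_nsmul, add_sub_cancel_right] at h1
  have h2 : clamp u h + clamp u (h + u) - u = (h ⊔ -u) ⊓ u := by
    rw [add_comm (clamp u h), ← h1, inf_sub, sup_sub, add_sub_cancel_right, zero_sub]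
    congr 1
    rw [succ_nsmul, one_nsmul, add_sub_cancel_right]
  have h3 : ((clamp u h + b) ⊓ u) + clamp u (h + u) - u =
      (((h ⊔ -u) ⊓ u) + b) ⊓ clamp u (h + u) := by
    rw [← h2, add_sub_assoc, inf_add, add_sub_cancel]
    congr 1
    abel
  rw [h3, sup_inf_right, inf_add, sup_add, sup_inf_right]
  have h4 : (h + b) ⊔ (-u + b) ⊔ 0 = (h + b) ⊔ 0 := by
    rw [sup_assoc, sup_eq_right.2 (show -u + b ≤ 0 by simpa using hbu)]
  have h5 : (u + b) ⊔ 0 = u + b := sup_eq_left.2 (add_nonneg hu hb)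
  have h6 : clamp u (h + u) ⊔ 0 = clamp u (h + u) := sup_eq_left.2 le_sup_right
  rw [h4, h5, h6, clamp_eq_inf hu, clamp_eq_inf hu]
  apply le_antisymm
  · refine le_inf (le_inf inf_le_left (inf_le_right.trans (le_add_of_nonneg_right hb)))
      (le_inf (inf_le_left.trans (sup_le_sup_right (by gcongr) 0)) inf_le_right)
  · exact le_inf (inf_le_left.trans inf_le_left) (inf_le_right.trans inf_le_right)

/-! ### MV-closed sets and the subgroups they generate -/

/-- A nonempty set of elements of the unit interval `[0, u]` closed under the MV-operations. -/
structure IsMVClosed (u : G) (S : Set G) : Prop where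
  nonempty : S.Nonempty
  nonneg : ∀ {x}, x ∈ S → 0 ≤ x
  le : ∀ {x}, x ∈ S → x ≤ u
  neg_mem : ∀ {x}, x ∈ S → u - x ∈ S
  imp_mem : ∀ {x y}, x ∈ S → y ∈ S → u ⊓ (u - x + y) ∈ S

namespace IsMVClosed

variable {u : G} {S : Set G}

omit [IsOrderedAddMonoid G] in
lemma top_nonneg (hS : IsMVClosed u S) : 0 ≤ u :=
  let ⟨_, hx⟩ := hS.nonempty
  (hS.nonneg hx).trans (hS.le hx)

omit [IsOrderedAddMonoid G] in
lemma top_mem (hS : IsMVClosed u S) : u ∈ S := by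
  obtain ⟨x, hx⟩ := hS.nonempty
  simpa using hS.imp_mem hx hx

omit [IsOrderedAddMonoid G] in
lemma zero_mem (hS : IsMVClosed u S) : 0 ∈ S := by
  simpa using hS.neg_mem hS.top_mem

omit [IsOrderedAddMonoid G] in
lemma oplus_mem (hS : IsMVClosed u S) {x y : G} (hx : x ∈ S) (hy : y ∈ S) :
    (x + y) ⊓ u ∈ S := by
  simpa [inf_comm] using hS.imp_mem (hS.neg_mem hx) hy

lemma odot_mem (hS : IsMVClosed u S) {x y : G} (hx : x ∈ S) (hy : y ∈ S) :
    (x + y - u) ⊔ 0 ∈ S := by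
  have h := hS.neg_mem (hS.oplus_mem (hS.neg_mem hx) (hS.neg_mem hy))
  rw [sub_inf, sub_self] at h
  convert h using 2
  abel

lemma clamp_zsmul_mem (hS : IsMVClosed u S) (k : ℤ) : clamp u (k • u) ∈ S := by
  have hu := hS.top_nonneg
  rcases le_or_gt k 0 with hk | hk
  · rw [clamp_of_nonpos]
    · exact hS.zero_mem
    · simpa using zsmul_le_zsmul_left hu hk
  · rw [clamp_of_le hu]
    · exact hS.top_mem
    · simpa using zsmul_le_zsmul_left hu (show 1 ≤ k by lia)

/-- Induction on the number of generators. All translates by multiples of `u` are carried along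
because `clamp_add` computes the truncation of `h + b` from those of both `h` and `h + u`. -/
lemma clamp_add_zsmul_mem (hS : IsMVClosed u S) {h : G} (hh : h ∈ AddSubgroup.closure S) :
    ∀ k : ℤ, clamp u (h + k • u) ∈ S := by
  have hu := hS.top_nonneg
  have add_right : ∀ x b : G, (∀ k : ℤ, clamp u (x + k • u) ∈ S) → b ∈ S →
      ∀ k : ℤ, clamp u (x + b + k • u) ∈ S := by
    intro x b hx hb k
    rw [add_right_comm, clamp_add (hS.nonneg hb) (hS.le hb)]
    have h1 := hx (k + 1)
    rw [add_zsmul, one_zsmul, ← add_assoc] at h1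
    exact hS.odot_mem (hS.oplus_mem (hx k) hb) h1
  induction hh using AddSubgroup.closure_induction_right with
  | zero => intro k; simpa using hS.clamp_zsmul_mem k
  | add_right x hx y hy ih => exact add_right x y ih hy
  | add_neg_cancel x hx y hy ih =>
    intro k
    -- Subtracting `y` is adding `u - y`, again in `S`, and shifting by `-u`.
    have h1 := add_right x (u - y) ih (hS.neg_mem hy) (k - 1)
    rw [sub_zsmul, one_zsmul] at h1
    convert h1 using 2
    abel

lemma clamp_mem (hS : IsMVClosed u S) {h : G} (hh : h ∈ AddSubgroup.closure S) :
    clamp u h ∈ S := by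
  simpa using hS.clamp_add_zsmul_mem hh 0

lemma sup_zero_inf_nsmul_mem (hS : IsMVClosed u S) {h : G} (hh : h ∈ AddSubgroup.closure S)
    (n : ℕ) : (h ⊔ 0) ⊓ n • u ∈ AddSubgroup.closure S := by
  rw [inf_nsmul_eq_sum_clamp hS.top_nonneg]
  refine sum_mem fun k _ => AddSubgroup.subset_closure (hS.clamp_mem (sub_mem hh ?_))
  exact nsmul_mem (AddSubgroup.subset_closure hS.top_mem) k

end IsMVClosed

end LatticeGroup

/-! ### The lattice-ordered group of a midpoint lattice -/

/-- A meet-semilattice with a cancellative midpoint operation, an origin, and reflection in the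
origin. -/
class MidpointLattice (A : Type*) extends SemilatticeInf A where
  mid : A → A → A
  origin : A
  refl : A → A
  mid_comm : ∀ a b, mid a b = mid b a
  mid_self : ∀ a, mid a a = a
  mid_mid_mid : ∀ a b c d, mid (mid a b) (mid c d) = mid (mid a c) (mid b d)
  mid_inf : ∀ a b c, mid (a ⊓ b) c = mid a c ⊓ mid b c
  le_of_mid_le : ∀ {a b c}, mid a c ≤ mid b c → a ≤ b
  mid_refl : ∀ a, mid a (refl a) = origin

namespace MidpointLattice

variable {A : Type*} [MidpointLattice A]

lemma mid_left_cancel {a b c : A} (h : mid a c = mid b c) : a = b :=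
  le_antisymm (le_of_mid_le h.le) (le_of_mid_le h.ge)

/-- The contraction with ratio one half towards the origin. -/
def halve (a : A) : A := mid a origin

lemma halve_mid (a b : A) : halve (mid a b) = mid (halve a) (halve b) := by
  unfold halve
  rw [mid_mid_mid a origin, mid_self]

lemma halve_inf (a b : A) : halve (a ⊓ b) = halve a ⊓ halve b := mid_inf a b _

lemma halve_injective : Function.Injective (halve : A → A) := fun _ _ h => mid_left_cancel h

lemma halve_origin : halve (origin : A) = origin := mid_self _

lemma halve_refl (a : A) : halve (refl a) = refl (halve a) := by
  apply mid_left_cancel (c := halve a)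
  rw [mid_comm, ← halve_mid, mid_refl, mid_comm, mid_refl, halve_origin]

lemma iterate_halve_refl (n : ℕ) (a : A) : halve^[n] (refl a) = refl (halve^[n] a) := by
  induction n with
  | zero => rfl
  | succ n ih => simp only [Function.iterate_succ_apply', ih, halve_refl]

lemma iterate_halve_origin (n : ℕ) : halve^[n] (origin : A) = origin := by
  induction n with
  | zero => rfl
  | succ n ih => simp only [Function.iterate_succ_apply', ih, halve_origin]

lemma iterate_halve_injective (n : ℕ) : Function.Injective (halve^[n] : A → A) :=
  halve_injective.iterate n

variable (A) in
/-- Two scaled elements `(i, a)` and `(j, b)`, standing for `2 ^ i • a` and `2 ^ j • b`, are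
identified when they agree at a common scale. -/
def scaledSetoid : Setoid (ℕ × A) where
  r x y := halve^[y.1] x.2 = halve^[x.1] y.2
  iseqv :=
    { refl := fun _ => rfl
      symm := fun h => h.symm
      trans := by
        rintro ⟨i, a⟩ ⟨j, b⟩ ⟨k, c⟩ hab hbc
        apply iterate_halve_injective j
        dsimp only at *
        rw [← Function.iterate_add_apply, add_comm, Function.iterate_add_apply, hab,
          ← Function.iterate_add_apply, add_comm, Function.iterate_add_apply, hbc,
          ← Function.iterate_add_apply, add_comm, Function.iterate_add_apply] }

variable (A) in
/-- The group of scaled elements of a midpoint lattice. -/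
def Envelope : Type _ := Quotient (scaledSetoid A)

namespace Envelope

/-- The element `2 ^ n • a`. -/
def mk (n : ℕ) (a : A) : Envelope A := Quotient.mk (scaledSetoid A) (n, a)

lemma mk_eq_mk {i j : ℕ} {a b : A} : mk i a = mk j b ↔ halve^[j] a = halve^[i] b :=
  Quotient.eq (r := scaledSetoid A)

lemma mk_inj {n : ℕ} {a b : A} : mk n a = mk n b ↔ a = b :=
  mk_eq_mk.trans (iterate_halve_injective n).eq_iff

lemma mk_iterate_halve (n k : ℕ) (a : A) : mk (n + k) (halve^[k] a) = mk n a := by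
  rw [mk_eq_mk, ← Function.iterate_add_apply]

lemma mk_halve (n : ℕ) (a : A) : mk (n + 1) (halve a) = mk n a := mk_iterate_halve n 1 a

lemma exists_mk (x : Envelope A) : ∃ n a, x = mk n a :=
  Quotient.inductionOn x fun p => ⟨p.1, p.2, rfl⟩

lemma exists_mk₂ (x y : Envelope A) : ∃ n a b, x = mk n a ∧ y = mk n b := by
  obtain ⟨i, a, rfl⟩ := exists_mk x
  obtain ⟨j, b, rfl⟩ := exists_mk y
  refine ⟨i + j, halve^[j] a, halve^[i] b, (mk_iterate_halve _ _ _).symm, ?_⟩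
  rw [add_comm, mk_iterate_halve]

lemma exists_mk₃ (x y z : Envelope A) : ∃ n a b c, x = mk n a ∧ y = mk n b ∧ z = mk n c := by
  obtain ⟨i, a, b, rfl, rfl⟩ := exists_mk₂ x y
  obtain ⟨j, c, rfl⟩ := exists_mk z
  refine ⟨i + j, halve^[j] a, halve^[j] b, halve^[i] c, (mk_iterate_halve _ _ _).symm,
    (mk_iterate_halve _ _ _).symm, ?_⟩
  rw [add_comm, mk_iterate_halve]

/-- Lift of a binary operation which commutes with halving and raises the scale by `s`. -/
def map₂ (s : ℕ) (f : A → A → A) (hf : ∀ a b, halve (f a b) = f (halve a) (halve b)) :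
    Envelope A → Envelope A → Envelope A :=
  Quotient.map₂ (sc := scaledSetoid A)
    (fun x y => (x.1 + y.1 + s, f (halve^[y.1] x.2) (halve^[x.1] y.2))) (by
      have hf' : ∀ n a b, halve^[n] (f a b) = f (halve^[n] a) (halve^[n] b) := by
        intro n a b
        induction n with
        | zero => rfl
        | succ n ih => simp only [Function.iterate_succ_apply', ih, hf]
      rintro ⟨i, a⟩ ⟨i', a'⟩ (h : halve^[i'] a = halve^[i] a') ⟨j, b⟩ ⟨j', b'⟩
        (h' : halve^[j'] b = halve^[j] b')
      change halve^[i' + j' + s] (f (halve^[j] a) (halve^[i] b)) =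
        halve^[i + j + s] (f (halve^[j'] a') (halve^[i'] b'))
      simp only [hf', ← Function.iterate_add_apply]
      congr 1
      · rw [show i' + j' + s + j = (j' + s + j) + i' by ring,
          show i + j + s + j' = (j' + s + j) + i by ring, Function.iterate_add_apply, h,
          ← Function.iterate_add_apply]
      · rw [show i' + j' + s + i = (i' + s + i) + j' by ring,
          show i + j + s + i' = (i' + s + i) + j by ring, Function.iterate_add_apply, h',
          ← Function.iterate_add_apply])

lemma map₂_mk (s : ℕ) (f : A → A → A) (hf) (n : ℕ) (a b : A) :
    map₂ s f hf (mk n a) (mk n b) = mk (n + s) (f a b) := by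
  have hf' : f (halve^[n] a) (halve^[n] b) = halve^[n] (f a b) := by
    have : ∀ n a b, halve^[n] (f a b) = f (halve^[n] a) (halve^[n] b) := by
      intro n a b
      induction n with
      | zero => rfl
      | succ n ih => simp only [Function.iterate_succ_apply', ih, hf]
    exact (this n a b).symm
  change mk (n + n + s) (f (halve^[n] a) (halve^[n] b)) = _
  rw [hf', add_right_comm, mk_iterate_halve]

/-- A midpoint is half a sum, so the scale goes up by one. -/
instance : Add (Envelope A) := ⟨map₂ 1 mid halve_mid⟩
instance : Min (Envelope A) := ⟨map₂ 0 (· ⊓ ·) halve_inf⟩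
instance : Zero (Envelope A) := ⟨mk 0 origin⟩
instance : Neg (Envelope A) :=
  ⟨Quotient.map (sa := scaledSetoid A) (fun x => (x.1, refl x.2)) (by
    rintro ⟨i, a⟩ ⟨j, b⟩ (h : halve^[j] a = halve^[i] b)
    change halve^[j] (refl a) = halve^[i] (refl b)
    rw [iterate_halve_refl, iterate_halve_refl, h])⟩

lemma mk_add_mk (n : ℕ) (a b : A) : mk n a + mk n b = mk (n + 1) (mid a b) :=
  map₂_mk 1 mid halve_mid n a b

lemma mk_inf_mk (n : ℕ) (a b : A) : mk n a ⊓ mk n b = mk n (a ⊓ b) :=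
  map₂_mk 0 (· ⊓ ·) halve_inf n a b

lemma neg_mk (n : ℕ) (a : A) : -mk n a = mk n (refl a) := rfl

lemma mk_origin (n : ℕ) : mk n (origin : A) = 0 := by
  rw [← iterate_halve_origin n]
  exact (congrArg (mk · _) (zero_add n)).symm.trans (mk_iterate_halve 0 n (origin : A))

instance : AddCommGroup (Envelope A) where
  add_assoc x y z := by
    obtain ⟨n, a, b, c, rfl, rfl, rfl⟩ := exists_mk₃ x y z
    rw [mk_add_mk, mk_add_mk, ← mk_halve n c, ← mk_halve n a, mk_add_mk, mk_add_mk, halve, halve,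
      mid_comm c origin, mid_mid_mid]
  zero_add x := by
    obtain ⟨n, a, rfl⟩ := exists_mk x
    rw [← mk_origin n, mk_add_mk, mid_comm, ← halve, mk_halve]
  add_zero x := by
    obtain ⟨n, a, rfl⟩ := exists_mk x
    rw [← mk_origin n, mk_add_mk, ← halve, mk_halve]
  nsmul := nsmulRec
  zsmul := zsmulRec
  neg_add_cancel x := by
    obtain ⟨n, a, rfl⟩ := exists_mk x
    rw [neg_mk, mk_add_mk, mid_comm, mid_refl, mk_origin]
  add_comm x y := by
    obtain ⟨n, a, b, rfl, rfl⟩ := exists_mk₂ x y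
    rw [mk_add_mk, mk_add_mk, mid_comm]

instance : SemilatticeInf (Envelope A) :=
  SemilatticeInf.mk'
    (fun x y => by
      obtain ⟨n, a, b, rfl, rfl⟩ := exists_mk₂ x y
      rw [mk_inf_mk, mk_inf_mk, inf_comm])
    (fun x y z => by
      obtain ⟨n, a, b, c, rfl, rfl, rfl⟩ := exists_mk₃ x y z
      simp only [mk_inf_mk, inf_assoc])
    (fun x => by
      obtain ⟨n, a, rfl⟩ := exists_mk x
      rw [mk_inf_mk, inf_idem])

lemma inf_add_distrib (x y z : Envelope A) : (x ⊓ y) + z = (x + z) ⊓ (y + z) := by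
  obtain ⟨n, a, b, c, rfl, rfl, rfl⟩ := exists_mk₃ x y z
  have h := mk_inf_mk n a b
  have h' := mk_inf_mk (n + 1) (mid a c) (mid b c)
  change mk n a ⊓ mk n b + mk n c = _
  rw [mk_add_mk, mk_add_mk, h, mk_add_mk, mid_inf]
  exact h'.symm

instance : IsOrderedAddMonoid (Envelope A) where
  add_le_add_left x y h z := by
    rw [← inf_eq_left] at h ⊢
    rw [← inf_add_distrib, h]

instance : Lattice (Envelope A) where
  __ := (inferInstance : SemilatticeInf (Envelope A))
  sup x y := -(-x ⊓ -y)
  le_sup_left _ _ := le_neg.2 inf_le_left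
  le_sup_right _ _ := le_neg.2 inf_le_right
  sup_le _ _ _ hx hy := neg_le.2 (le_inf (neg_le_neg hx) (neg_le_neg hy))

end Envelope

end MidpointLattice

/-! ### Wajsberg algebras with a halving operation -/

/-- Wajsberg algebras, presented with their natural order. -/
class WajsbergAlgebra (A : Type*) extends PartialOrder A, OrderTop A where
  imp : A → A → A
  neg : A → A
  imp_eq_top : ∀ {x y}, imp x y = ⊤ ↔ x ≤ y
  top_imp : ∀ x, imp ⊤ x = x
  le_imp : ∀ x y, x ≤ imp y x
  imp_le_imp_imp : ∀ x y z, imp x y ≤ imp (imp y z) (imp x z)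
  imp_imp_comm : ∀ x y, imp (imp x y) y = imp (imp y x) x
  neg_imp_neg_le : ∀ x y, imp (neg x) (neg y) ≤ imp y x

namespace WajsbergAlgebra

variable {A : Type*} [WajsbergAlgebra A]

lemma imp_imp_of_le {x y : A} (h : x ≤ y) : imp (imp y x) x = y := by
  rw [imp_imp_comm, imp_eq_top.2 h, top_imp]

lemma imp_le_imp_right {x y : A} (h : x ≤ y) (z : A) : imp y z ≤ imp x z := by
  have := imp_le_imp_imp x y z
  rwa [imp_eq_top.2 h, top_le_iff, imp_eq_top] at this

lemma le_imp_imp (x y : A) : x ≤ imp (imp x y) y := by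
  rw [imp_imp_comm]
  exact le_imp _ _

lemma le_imp_swap {x y z : A} (h : x ≤ imp y z) : y ≤ imp x z :=
  (le_imp_imp y z).trans (imp_le_imp_right h z)

lemma imp_left_comm (x y z : A) : imp x (imp y z) = imp y (imp x z) := by
  have key : ∀ x y z : A, imp x (imp y z) ≤ imp y (imp x z) := fun x y z =>
    le_imp_swap ((le_imp_imp y z).trans (le_imp_swap (imp_le_imp_imp x (imp y z) z)))
  exact le_antisymm (key _ _ _) (key _ _ _)

lemma imp_le_imp_left {x y : A} (h : x ≤ y) (z : A) : imp z x ≤ imp z y := by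
  have := imp_le_imp_imp z x y
  rwa [imp_eq_top.2 h, top_imp] at this

lemma neg_neg_le (x : A) : neg (neg x) ≤ x := by
  have h : neg (neg x) ≤ imp ⊤ x :=
    (le_imp _ _).trans ((neg_imp_neg_le _ _).trans (neg_imp_neg_le _ _))
  rwa [top_imp] at h

lemma neg_le_neg_iff_le {x y : A} (h : neg x ≤ neg y) : y ≤ x := by
  have := neg_imp_neg_le x y
  rwa [imp_eq_top.2 h, top_le_iff, imp_eq_top] at this

@[simp] lemma neg_neg (x : A) : neg (neg x) = x :=
  le_antisymm (neg_neg_le x) (neg_le_neg_iff_le (neg_neg_le (neg x)))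

lemma neg_le_neg {x y : A} (h : x ≤ y) : neg y ≤ neg x :=
  neg_le_neg_iff_le (by simpa using h)

lemma imp_neg_neg (x y : A) : imp (neg x) (neg y) = imp y x :=
  le_antisymm (neg_imp_neg_le _ _) (by simpa using neg_imp_neg_le (neg y) (neg x))

lemma imp_neg_comm (x y : A) : imp x (neg y) = imp y (neg x) := by
  simpa using imp_neg_neg (neg x) y

lemma neg_imp_comm (x y : A) : imp (neg x) y = imp (neg y) x := by
  simpa using imp_neg_neg x (neg y)

/-- Strong disjunction. -/
def oplus (x y : A) : A := imp (neg x) y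

/-- Truncated difference. -/
def ominus (x y : A) : A := neg (imp x y)

lemma oplus_comm (x y : A) : oplus x y = oplus y x := neg_imp_comm x y

lemma oplus_left_comm (x y z : A) : oplus x (oplus y z) = oplus y (oplus x z) :=
  imp_left_comm _ _ _

lemma oplus_assoc (x y z : A) : oplus (oplus x y) z = oplus x (oplus y z) := by
  rw [oplus_comm _ z, oplus_left_comm, oplus_comm z y]

lemma oplus_oplus_oplus_comm (a b c d : A) :
    oplus (oplus a b) (oplus c d) = oplus (oplus a c) (oplus b d) := by
  rw [oplus_assoc, oplus_left_comm b, ← oplus_assoc]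

lemma ominus_le_iff {x y z : A} : ominus x y ≤ z ↔ x ≤ oplus y z := by
  unfold ominus oplus
  constructor
  · intro h
    have h1 : neg z ≤ imp x y := by simpa using neg_le_neg h
    simpa [neg_imp_comm] using le_imp_swap h1
  · intro h
    rw [neg_imp_comm] at h
    simpa using neg_le_neg (le_imp_swap h)

lemma le_oplus_right (x y : A) : y ≤ oplus x y := le_imp _ _

lemma ominus_le (x y : A) : ominus x y ≤ x := ominus_le_iff.2 (le_oplus_right _ _)

lemma oplus_le_oplus_left {x y : A} (h : x ≤ y) (z : A) : oplus z x ≤ oplus z y :=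
  imp_le_imp_left h _

lemma oplus_le_oplus_right {x y : A} (h : x ≤ y) (z : A) : oplus x z ≤ oplus y z := by
  simpa only [oplus_comm _ z] using oplus_le_oplus_left h z

lemma oplus_ominus_of_le {x y : A} (h : y ≤ x) : oplus (ominus x y) y = x := by
  unfold oplus ominus
  rw [neg_neg, imp_imp_of_le h]

lemma ominus_le_ominus_right {x y : A} (h : x ≤ y) (z : A) : ominus x z ≤ ominus y z :=
  neg_le_neg (imp_le_imp_right h z)

lemma sup_isLUB {x y z : A} (hx : x ≤ z) (hy : y ≤ z) : imp (imp x y) y ≤ z :=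
  (imp_le_imp_right (imp_le_imp_right hx y) y).trans_eq (imp_imp_of_le hy)

/-- The greatest-lower-bound property is the De Morgan dual of `sup_isLUB`. -/
instance : SemilatticeInf A where
  inf x y := ominus x (ominus x y)
  inf_le_left x y := ominus_le _ _
  inf_le_right x y := by
    change neg (imp x (neg (imp x y))) ≤ y
    rw [imp_neg_comm, ← imp_neg_neg y x]
    refine neg_le_neg_iff_le ?_
    rw [neg_neg]
    exact le_imp_imp _ _
  le_inf x y z hy hz := by
    change x ≤ neg (imp y (neg (imp y z)))
    rw [imp_neg_comm, ← imp_neg_neg z y]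
    refine neg_le_neg_iff_le ?_
    rw [neg_neg]
    exact sup_isLUB (neg_le_neg hz) (neg_le_neg hy)

lemma inf_def (x y : A) : x ⊓ y = ominus x (ominus x y) := rfl

lemma ominus_oplus (x y : A) : ominus (oplus x y) y = x ⊓ neg y := by
  rw [inf_comm, inf_def]
  unfold ominus oplus
  rw [imp_neg_comm (neg y), neg_neg, neg_imp_comm x y]

lemma ominus_oplus_of_le {x y : A} (h : x ≤ neg y) : ominus (oplus x y) y = x := by
  rw [ominus_oplus, inf_of_le_left h]

lemma oplus_inf (x y z : A) : oplus x (y ⊓ z) = oplus x y ⊓ oplus x z := by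
  refine le_antisymm (le_inf (oplus_le_oplus_left inf_le_left _)
    (oplus_le_oplus_left inf_le_right _)) ?_
  rw [← ominus_le_iff]
  exact le_inf (ominus_le_iff.2 inf_le_left) (ominus_le_iff.2 inf_le_right)

lemma neg_oplus_self (x : A) : oplus (neg x) x = ⊤ := by
  rw [oplus, imp_eq_top, neg_neg]

lemma neg_top_le (x : A) : neg ⊤ ≤ x := neg_le_neg_iff_le (by simp)

end WajsbergAlgebra

/-- Wajsberg algebras with an operation of multiplication by one half. -/
class HalvedWajsbergAlgebra (A : Type*) extends WajsbergAlgebra A where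
  half : A → A
  half_ominus : ∀ x y, half (WajsbergAlgebra.ominus x y) =
    WajsbergAlgebra.ominus (half x) (half y)
  ominus_half : ∀ x, WajsbergAlgebra.ominus x (half x) = half x

namespace HalvedWajsbergAlgebra

open WajsbergAlgebra

variable {A : Type*} [HalvedWajsbergAlgebra A]

lemma half_le (x : A) : half x ≤ x := (ominus_half x).ge.trans (ominus_le _ _)

lemma half_oplus_half (x : A) : oplus (half x) (half x) = x := by
  have := oplus_ominus_of_le (half_le x)
  rwa [ominus_half] at this

lemma half_inf (x y : A) : half (x ⊓ y) = half x ⊓ half y := by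
  rw [inf_def, inf_def, half_ominus, half_ominus]

lemma half_mono {x y : A} (h : x ≤ y) : half x ≤ half y := by
  rw [← inf_eq_left] at h ⊢
  rw [← half_inf, h]

lemma neg_half_top : neg (half (⊤ : A)) = half ⊤ := by
  have := ominus_half (⊤ : A)
  rwa [ominus, top_imp] at this

lemma half_le_neg_half (x y : A) : half x ≤ neg (half y) :=
  (half_mono le_top).trans (neg_half_top.ge.trans (neg_le_neg (half_mono le_top)))

/-- Halving is only assumed to respect `ominus`, so the sum is rebuilt from the difference `(y ⊕ x)
⊖ x = y ⊓ neg x`. The cap `half ⊤` arises as `half x ⊕ half (neg x)`. -/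
lemma half_oplus (x y : A) : half (oplus x y) = half ⊤ ⊓ oplus (half x) (half y) := by
  have h1 : half (oplus y x) = oplus (half x) (half y ⊓ half (neg x)) := by
    have h2 := ominus_oplus y x
    rw [← half_inf, ← h2, half_ominus, oplus_comm (half x), oplus_ominus_of_le]
    exact half_mono (le_oplus_right _ _)
  have h3 : oplus (half x) (half (neg x)) = half ⊤ := by
    have h4 : neg x = ominus ⊤ x := by rw [ominus, top_imp]
    rw [h4, half_ominus, oplus_comm, oplus_ominus_of_le (half_mono le_top)]
  rw [oplus_comm x, h1, oplus_inf, h3, inf_comm]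

lemma half_oplus_of_le {x y : A} (h : x ≤ neg y) :
    half (oplus x y) = oplus (half x) (half y) := by
  have h1 := ominus_oplus_of_le h
  conv_rhs => rw [← h1, half_ominus]
  rw [oplus_ominus_of_le]
  exact half_mono (le_oplus_right _ _)

/-- Coordinates are centred: with origin `half ⊤`, an element `x` stands for `x - 1/2`, and negation
becomes reflection. Adding `mk 0 ⊤`, that is `1/2`, in `toEnvelope` undoes this shift. -/
instance : MidpointLattice A where
  mid x y := oplus (half x) (half y)
  origin := half ⊤
  refl := neg
  mid_comm x y := oplus_comm _ _
  mid_self := half_oplus_half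
  mid_mid_mid a b c d := by
    simp only [half_oplus_of_le (half_le_neg_half _ _)]
    exact oplus_oplus_oplus_comm _ _ _ _
  mid_inf a b c := by
    rw [half_inf, oplus_comm, oplus_inf, oplus_comm (half c), oplus_comm (half c)]
  le_of_mid_le {a b c} h := by
    have h1 := ominus_le_ominus_right h (half c)
    rw [ominus_oplus_of_le (half_le_neg_half _ _), ominus_oplus_of_le (half_le_neg_half _ _)] at h1
    rw [← half_oplus_half a, ← half_oplus_half b]
    exact (oplus_le_oplus_left h1 _).trans (oplus_le_oplus_right h1 _)
  mid_refl a := by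
    rw [← half_oplus_of_le (by simp), oplus_comm, neg_oplus_self]

open MidpointLattice

lemma half_neg_top : half (neg (⊤ : A)) = neg ⊤ :=
  le_antisymm (half_le _) (neg_top_le _)

lemma oplus_neg_top (x : A) : oplus x (neg ⊤) = x := by
  rw [oplus_comm, oplus, WajsbergAlgebra.neg_neg, top_imp]

variable (A) in
/-- The unit of the enveloping group. -/
def unit : Envelope A := Envelope.mk 0 ⊤ + Envelope.mk 0 ⊤

/-- The embedding of the algebra as the unit interval of its enveloping group. -/
def toEnvelope (x : A) : Envelope A := Envelope.mk 0 x + Envelope.mk 0 ⊤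

lemma toEnvelope_top : toEnvelope (⊤ : A) = unit A := rfl

lemma toEnvelope_injective : Function.Injective (toEnvelope : A → Envelope A) := fun _ _ h =>
  Envelope.mk_inj.1 (add_right_cancel h)

lemma mk_neg (n : ℕ) (x : A) : Envelope.mk n (neg x) = -Envelope.mk n x := rfl

lemma toEnvelope_neg (x : A) : toEnvelope (neg x) = unit A - toEnvelope x := by
  simp only [toEnvelope, unit, mk_neg]
  abel

lemma toEnvelope_imp (x y : A) :
    toEnvelope (imp x y) = unit A ⊓ (unit A - toEnvelope x + toEnvelope y) := by
  -- This is `half_oplus` in centred coordinates: `(x → y) - 1 = min 0 (y - x)`.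
  have h1 : Envelope.mk 0 (imp x y) + Envelope.mk 0 (neg ⊤) =
      0 ⊓ (Envelope.mk 0 (neg x) + Envelope.mk 0 y) := by
    rw [Envelope.mk_add_mk, Envelope.mk_add_mk, ← Envelope.mk_origin 1]
    refine Eq.trans ?_ (Envelope.mk_inf_mk _ _ _).symm
    congr 1
    change oplus (half _) (half _) = half ⊤ ⊓ oplus _ _
    rw [← half_oplus, half_neg_top, oplus_neg_top, oplus, WajsbergAlgebra.neg_neg]
  have h2 : toEnvelope (imp x y) =
      Envelope.mk 0 (imp x y) + Envelope.mk 0 (neg ⊤) + unit A := by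
    simp only [toEnvelope, unit, mk_neg]
    abel
  rw [h2, h1, inf_add, zero_add]
  congr 1
  simp only [toEnvelope, unit, mk_neg]
  abel

lemma toEnvelope_le (x : A) : toEnvelope x ≤ unit A := by
  have h := toEnvelope_imp ⊤ x
  rw [top_imp] at h
  exact h.trans_le inf_le_left

lemma toEnvelope_nonneg (x : A) : 0 ≤ toEnvelope x := by
  have h := toEnvelope_le (neg x)
  rwa [toEnvelope_neg, sub_le_self_iff] at h

end HalvedWajsbergAlgebra

/-! ### The Lindenbaum algebra -/

namespace ScalarForm

variable {K : Type*} [Field K] [LinearOrder K] [IsStrictOrderedRing K] {V : Type*}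

lemma Derives.cut {Θ Θ' : Set (ScalarForm K V)} {φ : ScalarForm K V} (h : Derives Θ φ)
    (hΘ : ∀ θ ∈ Θ, Derives Θ' θ) : Derives Θ' φ := by
  induction h with
  | ax h => exact .ax h
  | hyp h => exact hΘ _ h
  | mp _ _ ih₁ ih₂ => exact .mp ih₁ ih₂

lemma Derives.mono {Θ Θ' : Set (ScalarForm K V)} {φ : ScalarForm K V} (h : Derives Θ φ)
    (hΘ : Θ ⊆ Θ') : Derives Θ' φ :=
  h.cut fun _ hθ => .hyp (hΘ hθ)

lemma Thm_eq_Thm {Θ Θ' : Set (ScalarForm K V)} (h : ∀ θ ∈ Θ, Derives Θ' θ)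
    (h' : ∀ θ ∈ Θ', Derives Θ θ) : Thm Θ = Thm Θ' :=
  Set.Subset.antisymm (fun _ hφ => Derives.cut hφ h) (fun _ hφ => Derives.cut hφ h')

/-- Provability of the implication `φ → ψ`. -/
def Entails (φ ψ : ScalarForm K V) : Prop := Derives ∅ (imp φ ψ)

/-! ### Derivations from the Łukasiewicz axioms -/

namespace Entails

variable {φ φ' ψ ψ' χ : ScalarForm K V}

lemma mp (h : Derives ∅ φ) (h' : Entails φ ψ) : Derives ∅ ψ := .mp h h'

lemma trans (h : Entails φ ψ) (h' : Entails ψ χ) : Entails φ χ := .mp h' (.mp h (.ax (.l2 _ _ _)))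

lemma imp_self_right (φ ψ : ScalarForm K V) : Entails φ (imp ψ φ) := .ax (.l1 _ _)

lemma of_derives (φ : ScalarForm K V) (h : Derives ∅ ψ) : Entails φ ψ := .mp h (.ax (.l1 _ _))

lemma of_derives_imp (h : Derives ∅ φ) (ψ : ScalarForm K V) : Entails (imp φ ψ) ψ :=
  .mp (of_derives (imp ψ φ) h) (.ax (.l3 _ _))

/-- Contraction is not available, so identity is obtained from the commutativity of `∨`, through
`of_derives_imp`. -/
lemma refl (φ : ScalarForm K V) : Entails φ φ :=
  (imp_self_right φ (imp φ (imp φ φ))).trans (of_derives_imp (imp_self_right φ φ) φ)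

lemma imp_left (h : Entails φ ψ) (χ : ScalarForm K V) : Entails (imp ψ χ) (imp φ χ) :=
  .mp h (.ax (.l2 _ _ _))

lemma imp_imp_self (φ ψ : ScalarForm K V) : Entails φ (imp (imp φ ψ) ψ) :=
  (imp_self_right φ (imp ψ φ)).trans (.ax (.l3 _ _))

lemma swap (h : Entails φ (imp ψ χ)) : Entails ψ (imp φ χ) :=
  (imp_imp_self ψ χ).trans (h.imp_left χ)

lemma imp_right (h : Entails φ ψ) (χ : ScalarForm K V) : Entails (imp χ φ) (imp χ ψ) :=
  .mp h (swap (.ax (.l2 _ _ _)))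

lemma neg_imp (φ ψ : ScalarForm K V) : Entails (neg φ) (imp φ ψ) :=
  (imp_self_right _ (neg ψ)).trans (.ax (.l4 _ _))

lemma neg_neg_left (φ : ScalarForm K V) : Entails (neg (neg φ)) φ :=
  ((neg_imp (neg φ) (neg (imp φ φ))).trans (.ax (.l4 _ _))).trans (of_derives_imp (refl φ) φ)

lemma neg_neg_right (φ : ScalarForm K V) : Entails φ (neg (neg φ)) :=
  .mp (neg_neg_left (neg φ)) (.ax (.l4 _ _))

lemma neg (h : Entails φ ψ) : Entails (neg ψ) (neg φ) :=
  .mp (((neg_neg_left φ).trans h).trans (neg_neg_right ψ)) (.ax (.l4 _ _))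

end Entails

/-- Provable equivalence. -/
def Equivalent (φ ψ : ScalarForm K V) : Prop := Entails φ ψ ∧ Entails ψ φ

lemma Equivalent.of_iff {φ ψ : ScalarForm K V} (h : Derives ∅ (iff φ ψ)) : Equivalent φ ψ :=
  ⟨.mp h (((Entails.neg_imp (neg (imp φ ψ)) _).swap.neg).trans (Entails.neg_neg_left _)),
    .mp h ((Entails.imp_self_right (neg (imp ψ φ)) (neg (neg (imp φ ψ)))).neg.trans
      (Entails.neg_neg_left _))⟩

lemma scalarMinus_self (r : Set.Icc (0 : K) 1) : scalarMinus r r = 0 :=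
  Subtype.ext (by simp [scalarMinus])

lemma scalarMinus_one (r : Set.Icc (0 : K) 1) : scalarMinus r 1 = 0 :=
  Subtype.ext (by simpa [scalarMinus] using r.2.2)

/-- Both `r ⊖ r` and `r ⊖ 1` are `0`. The first makes `∇_0 φ` provable, and the second turns that
into `∇_1 φ → ∇_r φ`. This supplies necessitation for `∇_r`, hence its compatibility with
entailment. -/
lemma entails_nabla_self (r : Set.Icc (0 : K) 1) (φ : ScalarForm K V) :
    Entails φ (nabla r φ) := by
  have h0 : Derives ∅ (nabla 0 φ) := by
    have h := (Equivalent.of_iff (.ax (.r2 r r φ))).2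
    rw [scalarMinus_self] at h
    exact Entails.mp (Entails.refl _) h
  have h := (Equivalent.of_iff (.ax (.r2 r 1 φ))).1
  rw [scalarMinus_one] at h
  exact (Equivalent.of_iff (.ax (.r4 φ))).2.trans (h0.mp h)

lemma Entails.nabla {φ ψ : ScalarForm K V} (h : Entails φ ψ) (r : Set.Icc (0 : K) 1) :
    Entails (nabla r φ) (nabla r ψ) :=
  (Derives.mp h (entails_nabla_self r _)).mp (Equivalent.of_iff (.ax (.r1 r φ ψ))).1

/-- Provable equivalence as a setoid. -/
def entailsSetoid (K : Type*) [Field K] [LinearOrder K] [IsStrictOrderedRing K] (V : Type*) :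
    Setoid (ScalarForm K V) where
  r := Equivalent
  iseqv :=
    { refl := fun φ => ⟨.refl φ, .refl φ⟩
      symm := fun h => ⟨h.2, h.1⟩
      trans := fun h h' => ⟨h.1.trans h'.1, h'.2.trans h.2⟩ }

/-- The Lindenbaum algebra: formulas up to provable equivalence. -/
def Lindenbaum (K : Type*) [Field K] [LinearOrder K] [IsStrictOrderedRing K] (V : Type*) :
    Type _ :=
  Quotient (entailsSetoid K V)

/-- The class of a formula. -/
def toLindenbaum (φ : ScalarForm K V) : Lindenbaum K V := Quotient.mk (entailsSetoid K V) φ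

namespace Lindenbaum

lemma ind {p : Lindenbaum K V → Prop} (h : ∀ φ, p (toLindenbaum φ)) (x) : p x :=
  Quotient.ind h x

lemma mk_eq_mk {φ ψ : ScalarForm K V} :
    toLindenbaum φ = toLindenbaum ψ ↔ Equivalent φ ψ :=
  Quotient.eq (r := entailsSetoid K V)

instance : PartialOrder (Lindenbaum K V) where
  le := Quotient.lift₂ (s₁ := entailsSetoid K V) (s₂ := entailsSetoid K V) Entails
    fun _ _ _ _ h h' => propext ⟨fun H => h.2.trans (H.trans h'.1),
      fun H => h.1.trans (H.trans h'.2)⟩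
  le_refl := ind fun φ => Entails.refl φ
  le_trans := by
    refine ind fun φ => ind fun ψ => ind fun χ => ?_
    exact Entails.trans
  le_antisymm := by
    refine ind fun φ => ind fun ψ => ?_
    exact fun h h' => mk_eq_mk.2 ⟨h, h'⟩

/-- The operation on classes induced by `∇_r`. -/
def nabla (r : Set.Icc (0 : K) 1) : Lindenbaum K V → Lindenbaum K V :=
  Quotient.map (sa := entailsSetoid K V) (ScalarForm.nabla r)
    fun _ _ h => ⟨h.1.nabla r, h.2.nabla r⟩

variable [Nonempty (ScalarForm K V)]

variable (K V) in
/-- Some provable formula. -/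
noncomputable def verum : ScalarForm K V :=
  let φ := Classical.arbitrary (ScalarForm K V)
  imp φ φ

lemma derives_verum : Derives ∅ (verum K V) := Entails.refl _

noncomputable instance : WajsbergAlgebra (Lindenbaum K V) where
  top := toLindenbaum (verum K V)
  le_top := ind fun φ => Entails.of_derives φ derives_verum
  imp := Quotient.map₂ (sa := entailsSetoid K V) (sb := entailsSetoid K V) ScalarForm.imp
    fun _ _ h _ _ h' => ⟨(h.2.imp_left _).trans (h'.1.imp_right _),
      (h.1.imp_left _).trans (h'.2.imp_right _)⟩
  neg := Quotient.map (sa := entailsSetoid K V) ScalarForm.neg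
    fun _ _ h => ⟨h.2.neg, h.1.neg⟩
  imp_eq_top {x y} := by
    induction x using ind with | _ φ
    induction y using ind with | _ ψ
    refine (mk_eq_mk (φ := imp φ ψ)).trans ⟨fun h => ?_, fun h => ⟨?_, ?_⟩⟩
    · exact derives_verum.mp h.2
    · exact Entails.of_derives _ derives_verum
    · exact Entails.of_derives _ h
  top_imp := ind fun φ =>
    mk_eq_mk.2 ⟨Entails.of_derives_imp derives_verum φ, Entails.imp_self_right _ _⟩
  le_imp := ind fun φ => ind fun ψ => Entails.imp_self_right φ ψ
  imp_le_imp_imp := ind fun φ => ind fun ψ => ind fun χ => Derives.ax (.l2 φ ψ χ)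
  imp_imp_comm := ind fun φ => ind fun ψ => mk_eq_mk.2 ⟨.ax (.l3 φ ψ), .ax (.l3 ψ φ)⟩
  neg_imp_neg_le := ind fun φ => ind fun ψ => Derives.ax (.l4 ψ φ)

lemma mk_eq_top {φ : ScalarForm K V} : toLindenbaum φ = ⊤ ↔ Derives ∅ φ :=
  (mk_eq_mk (φ := φ) (ψ := verum K V)).trans
    ⟨fun h => derives_verum.mp h.2,
      fun h => ⟨Entails.of_derives _ derives_verum, Entails.of_derives _ h⟩⟩

lemma nabla_imp (r : Set.Icc (0 : K) 1) (x y : Lindenbaum K V) :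
    nabla r (WajsbergAlgebra.imp x y) = WajsbergAlgebra.imp (nabla r x) (nabla r y) := by
  induction x using ind with | _ φ
  induction y using ind with | _ ψ
  exact mk_eq_mk.2 (.of_iff (.ax (.r1 r φ ψ)))

lemma nabla_scalarMinus (r q : Set.Icc (0 : K) 1) (x : Lindenbaum K V) :
    nabla (scalarMinus r q) x = WajsbergAlgebra.imp (nabla q x) (nabla r x) := by
  induction x using ind with | _ φ
  exact mk_eq_mk.2 (.of_iff (.ax (.r2 r q φ)))

omit [Nonempty (ScalarForm K V)] in
lemma nabla_one (x : Lindenbaum K V) : nabla 1 x = x := by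
  induction x using ind with | _ φ
  exact mk_eq_mk.2 (.of_iff (.ax (.r4 φ)))

variable (K) in
/-- The scalar `1 / 2`. -/
def oneHalf : Set.Icc (0 : K) 1 := ⟨1 / 2, by positivity, by linarith [show (1:K)/2 + 1/2 = 1 by ring]⟩

lemma one_scalarMinus_oneHalf : scalarMinus 1 (oneHalf K) = oneHalf K :=
  Subtype.ext (by norm_num [scalarMinus, oneHalf])

-- Halving is `Δ_{1/2}`; the law `x ⊖ x/2 = x/2` comes from the scalar identity `1 ⊖ 1/2 = 1/2`.
open WajsbergAlgebra in
noncomputable instance : HalvedWajsbergAlgebra (Lindenbaum K V) where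
  half x := WajsbergAlgebra.neg (nabla (oneHalf K) (WajsbergAlgebra.neg x))
  half_ominus x y := by
    unfold ominus
    rw [WajsbergAlgebra.neg_neg, imp_neg_neg, ← nabla_imp, imp_neg_neg]
  ominus_half x := by
    have h := nabla_scalarMinus 1 (oneHalf K) (WajsbergAlgebra.neg x)
    rw [one_scalarMinus_oneHalf, nabla_one] at h
    unfold ominus
    rw [imp_neg_comm, ← h]

end Lindenbaum

/-! ### Formula values and deficits in the enveloping group -/

open HalvedWajsbergAlgebra

variable [Nonempty (ScalarForm K V)]

/-- The value of a formula in the enveloping group of the Lindenbaum algebra. -/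
noncomputable def value (φ : ScalarForm K V) : MidpointLattice.Envelope (Lindenbaum K V) :=
  toEnvelope (toLindenbaum φ)

local notation "𝟙" => unit (Lindenbaum K V)

lemma value_neg (φ : ScalarForm K V) : value (neg φ) = 𝟙 - value φ := toEnvelope_neg (toLindenbaum φ)

lemma value_imp (φ ψ : ScalarForm K V) :
    value (imp φ ψ) = 𝟙 ⊓ (𝟙 - value φ + value ψ) :=
  toEnvelope_imp (toLindenbaum φ) (toLindenbaum ψ)

lemma value_le (φ : ScalarForm K V) : value φ ≤ 𝟙 := toEnvelope_le _

lemma value_nonneg (φ : ScalarForm K V) : 0 ≤ value φ := toEnvelope_nonneg _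

lemma value_eq_unit {φ : ScalarForm K V} : value φ = 𝟙 ↔ Derives ∅ φ := by
  rw [← Lindenbaum.mk_eq_top, ← toEnvelope_top]
  exact toEnvelope_injective.eq_iff

/-- The deduction theorem, expressed by means of values. -/
lemma derives_of_le_nsmul {φ ψ : ScalarForm K V} (n : ℕ)
    (h : 𝟙 - value ψ ≤ n • (𝟙 - value φ)) : Derives {φ} ψ := by
  induction n generalizing ψ with
  | zero =>
    rw [zero_nsmul, sub_nonpos] at h
    exact (value_eq_unit.1 (le_antisymm (value_le ψ) h)).mono (Set.empty_subset _)
  | succ n ih =>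
    -- The deficit of `φ → ψ` is that of `ψ` minus that of `φ`, truncated at `0`, so one copy of the
    -- hypothesis is spent.
    refine .mp (.hyp rfl) (ih (ψ := imp φ ψ) ?_)
    rw [value_imp, sub_inf, sub_self]
    refine sup_le (nsmul_nonneg (sub_nonneg.2 (value_le φ)) n) ?_
    rw [succ_nsmul] at h
    rw [← add_le_add_iff_right (𝟙 - value φ)]
    refine le_trans (le_of_eq ?_) h
    abel

lemma value_nabla_scalarMinus (r q : Set.Icc (0 : K) 1) (φ : ScalarForm K V) :
    𝟙 - value (nabla (scalarMinus r q) φ) =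
      ((𝟙 - value (nabla r φ)) - (𝟙 - value (nabla q φ))) ⊔ 0 := by
  have h : value (nabla (scalarMinus r q) φ) = value (imp (nabla q φ) (nabla r φ)) :=
    congrArg toEnvelope (Lindenbaum.nabla_scalarMinus r q (toLindenbaum φ))
  rw [h, value_imp, sub_inf, sub_self, sup_comm]
  congr 1
  abel

lemma value_nabla_one (φ : ScalarForm K V) : value (nabla 1 φ) = value φ :=
  congrArg toEnvelope (Lindenbaum.nabla_one (toLindenbaum φ))

/-- The deficit of `∇_r φ` behaves like `r` times that of `φ`. It is monotone in `r`: for `q ≤ r`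
the scalar `q ⊖ r` equals `r ⊖ r`, whose deficit is `0`. Hence no truncation occurs. -/
lemma value_nabla_scalarMinus_of_le {r q : Set.Icc (0 : K) 1} (h : q ≤ r) (φ : ScalarForm K V) :
    𝟙 - value (nabla (scalarMinus r q) φ) =
      (𝟙 - value (nabla r φ)) - (𝟙 - value (nabla q φ)) := by
  rw [value_nabla_scalarMinus, sup_eq_left, sub_nonneg]
  have h0 : scalarMinus q r = scalarMinus r r :=
    Subtype.ext (by simpa [scalarMinus] using h)
  have h1 := value_nabla_scalarMinus q r φ
  rw [h0, value_nabla_scalarMinus, sub_self, sup_idem] at h1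
  exact sub_nonpos.1 (h1.symm ▸ le_sup_left)

/-- The scalar `k / n`. -/
def ratio (k n : ℕ) (h : k ≤ n) : Set.Icc (0 : K) 1 :=
  ⟨k / n, by positivity, div_le_one_of_le₀ (by exact_mod_cast h) (by positivity)⟩

lemma value_nabla_ratio {k n : ℕ} (hn : 1 ≤ n) (hk : k ≤ n) (φ : ScalarForm K V) :
    𝟙 - value (nabla (ratio k n hk) φ) = k • (𝟙 - value (nabla (ratio 1 n hn) φ)) := by
  induction k with
  | zero =>
    have h : ratio 0 n hk = scalarMinus (1 : Set.Icc (0 : K) 1) 1 :=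
      Subtype.ext (by simp [ratio, scalarMinus])
    rw [h, value_nabla_scalarMinus_of_le le_rfl, sub_self, zero_nsmul]
  | succ k ih =>
    have hle : ratio k n (Nat.le_of_succ_le hk) ≤ (ratio (k + 1) n hk : Set.Icc (0 : K) 1) :=
      Subtype.mk_le_mk.2 (by gcongr; lia)
    have h1 := value_nabla_scalarMinus_of_le hle φ
    have h2 : scalarMinus (ratio (k + 1) n hk) (ratio k n (Nat.le_of_succ_le hk)) =
        (ratio 1 n hn : Set.Icc (0 : K) 1) := by
      refine Subtype.ext ?_
      have : ((k + 1 : ℕ) : K) / n - k / n = 1 / n := by push_cast; ring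
      simp only [scalarMinus, ratio, this, Nat.cast_one]
      exact max_eq_right (by positivity)
    rw [h2, eq_sub_iff_add_eq, ih] at h1
    rw [← h1, succ_nsmul']

/-- Clears the denominator of a rational scalar: both sides are `k` times the `n`-fold sum of the
deficit of `∇_{1/n} φ`. -/
lemma nsmul_value_nabla_ratio {k n : ℕ} (hn : 1 ≤ n) (hk : k ≤ n) (φ : ScalarForm K V) :
    n • (𝟙 - value (nabla (ratio k n hk) φ)) = k • (𝟙 - value φ) := by
  have h1 : ratio n n le_rfl = (1 : Set.Icc (0 : K) 1) :=
    Subtype.ext (div_self (Nat.cast_ne_zero.2 (by lia)))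
  rw [value_nabla_ratio hn hk, ← value_nabla_one φ, ← h1, value_nabla_ratio hn le_rfl, nsmul_left_comm]

end ScalarForm

/-! ### Rational scalars -/

namespace ScalarForm

open HalvedWajsbergAlgebra LatticeGroup

variable {K : Type*} [Field K] [LinearOrder K] [IsStrictOrderedRing K] {V : Type*}

lemma nonempty_var (φ : ScalarForm K V) : Nonempty V := by
  induction φ with
  | var v => exact ⟨v⟩
  | neg _ ih => exact ih
  | imp _ _ ih _ => exact ih
  | nabla _ _ ih => exact ih

variable (K V) in
/-- The values of the formulas of plain Łukasiewicz logic. -/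
def lukValues [Nonempty (ScalarForm K V)] : Set (MidpointLattice.Envelope (Lindenbaum K V)) :=
  Set.range fun β : LukForm V => value (β.toScalar K)

lemma isMVClosed_lukValues [Nonempty (ScalarForm K V)] :
    IsMVClosed (unit (Lindenbaum K V)) (lukValues K V) where
  nonempty :=
    let ⟨v⟩ := nonempty_var (Classical.arbitrary (ScalarForm K V))
    ⟨_, .var v, rfl⟩
  nonneg := by rintro _ ⟨β, rfl⟩; exact value_nonneg _
  le := by rintro _ ⟨β, rfl⟩; exact value_le _
  neg_mem := by rintro _ ⟨β, rfl⟩; exact ⟨.neg β, value_neg _⟩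
  imp_mem := by rintro _ _ ⟨β, rfl⟩ ⟨γ, rfl⟩; exact ⟨.imp β γ, value_imp _ _⟩

/-- Denominators are cleared connective by connective. For implication, multiples distribute over
the meet with `u`, and the subgroup is closed under truncation to `[0, n • u]` by slicing. -/
lemma exists_nsmul_value_mem [Nonempty (RatLukForm V)] (φ : RatLukForm V) :
    ∃ N : ℕ, 1 ≤ N ∧ N • value φ ∈ AddSubgroup.closure (lukValues ℚ V) := by
  have hS := isMVClosed_lukValues (K := ℚ) (V := V)
  have hu := AddSubgroup.subset_closure hS.top_mem
  induction φ with
  | var v => exact ⟨1, le_rfl, by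
      rw [one_nsmul]; exact AddSubgroup.subset_closure ⟨.var v, rfl⟩⟩
  | neg φ ih =>
    obtain ⟨N, hN, h⟩ := ih
    exact ⟨N, hN, by rw [value_neg, nsmul_sub]; exact sub_mem (nsmul_mem hu N) h⟩
  | imp φ ψ ihφ ihψ =>
    obtain ⟨N, hN, hφ⟩ := ihφ
    obtain ⟨M, hM, hψ⟩ := ihψ
    refine ⟨M * N, Nat.mul_pos hM hN, ?_⟩
    have h1 : (M * N) • (unit (Lindenbaum ℚ V) - value φ + value ψ) ∈
        AddSubgroup.closure (lukValues ℚ V) := by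
      rw [nsmul_add, nsmul_sub, mul_nsmul' (value φ), mul_nsmul (value ψ)]
      exact add_mem (sub_mem (nsmul_mem hu _) (nsmul_mem hφ _)) (nsmul_mem hψ _)
    have h2 := hS.sup_zero_inf_nsmul_mem h1 (M * N)
    have h3 : 0 ≤ unit (Lindenbaum ℚ V) - value φ + value ψ :=
      add_nonneg (sub_nonneg.2 (value_le φ)) (value_nonneg ψ)
    rw [sup_eq_left.2 (nsmul_nonneg h3 _)] at h2
    rwa [value_imp, inf_comm, nsmul_inf]
  | nabla r φ ih =>
    obtain ⟨N, hN, h⟩ := ih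
    have hr0 : 0 ≤ (r : ℚ).num := Rat.num_nonneg.2 r.2.1
    have hk : (r : ℚ).num.toNat ≤ (r : ℚ).den := by
      have := Rat.num_le_denom_iff.2 r.2.2
      lia
    have hr : r = ratio (r : ℚ).num.toNat (r : ℚ).den hk := by
      refine Subtype.ext ?_
      have : (((r : ℚ).num.toNat : ℕ) : ℚ) = ((r : ℚ).num : ℚ) := by
        exact_mod_cast Int.toNat_of_nonneg hr0
      simp only [ratio, this, Rat.num_div_den]
    have h1 := nsmul_value_nabla_ratio (r : ℚ).den_pos hk φ
    rw [← hr] at h1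
    refine ⟨(r : ℚ).den * N, Nat.mul_pos (r : ℚ).den_pos hN, ?_⟩
    have h2 : ((r : ℚ).den * N) • value (nabla r φ) =
        ((r : ℚ).den * N) • unit (Lindenbaum ℚ V) -
          (r : ℚ).num.toNat • (N • unit (Lindenbaum ℚ V) - N • value φ) := by
      rw [← nsmul_sub, nsmul_left_comm, ← h1, nsmul_left_comm, ← mul_nsmul', ← nsmul_sub,
        sub_sub_cancel]
    rw [h2]
    exact sub_mem (nsmul_mem hu _) (nsmul_mem (sub_mem (nsmul_mem hu _) h) _)

lemma exists_lukForm_interderivable (φ : RatLukForm V) :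
    ∃ β : LukForm V, Derives {φ} (β.toScalar ℚ) ∧ Derives {β.toScalar ℚ} φ := by
  -- Without variables there are no formulas; `φ` itself ensures that the Lindenbaum algebra has a
  -- top.
  have : Nonempty (RatLukForm V) := ⟨φ⟩
  have hS := isMVClosed_lukValues (K := ℚ) (V := V)
  obtain ⟨N, hN, h⟩ := exists_nsmul_value_mem φ
  have hx : 0 ≤ unit (Lindenbaum ℚ V) - value φ := sub_nonneg.2 (value_le φ)
  have h1 : N • (unit (Lindenbaum ℚ V) - value φ) ∈ AddSubgroup.closure (lukValues ℚ V) := by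
    rw [nsmul_sub]
    exact sub_mem (nsmul_mem (AddSubgroup.subset_closure hS.top_mem) N) h
  have h2 := hS.clamp_mem h1
  rw [clamp_of_nonneg hS.top_nonneg (nsmul_nonneg hx N)] at h2
  obtain ⟨β, hβ : value (β.toScalar ℚ) = _⟩ := hS.neg_mem h2
  refine ⟨β, derives_of_le_nsmul N ?_, derives_of_le_nsmul 1 ?_⟩
  · rw [hβ, sub_sub_cancel]
    exact inf_le_left
  · rw [hβ, sub_sub_cancel, one_nsmul]
    -- Here `N ≥ 1` matters: it gives `x ≤ N • x`.
    exact le_inf (le_self_nsmul hx (by lia)) (sub_le_self _ (value_nonneg φ))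

lemma isLukGenerated_of_isTheory {T : Set (RatLukForm V)} (hT : IsTheory T) :
    IsLukGenerated T := by
  obtain ⟨Θ, rfl⟩ := hT
  choose β hβ hβ' using exists_lukForm_interderivable (V := V)
  refine ⟨β '' Θ, Thm_eq_Thm (fun θ hθ => (hβ' θ).mono ?_) ?_⟩
  · rintro _ rfl
    exact ⟨_, ⟨θ, hθ, rfl⟩, rfl⟩
  · rintro _ ⟨_, ⟨θ, hθ, rfl⟩, rfl⟩
    exact (hβ θ).mono (Set.singleton_subset_iff.2 hθ)

end ScalarForm

/-! ### Semantics in the real unit interval -/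

namespace ScalarForm

open Filter Topology

variable {V : Type*}

/-- The standard interpretation in the real unit interval. -/
def eval (w : V → ℝ) : RieszLukForm V → ℝ
  | var v => w v
  | neg φ => 1 - φ.eval w
  | imp φ ψ => min 1 (1 - φ.eval w + ψ.eval w)
  | nabla r φ => 1 - r * (1 - φ.eval w)

lemma eval_mem_Icc {w : V → ℝ} (hw : ∀ v, w v ∈ Set.Icc (0 : ℝ) 1) (φ : RieszLukForm V) :
    φ.eval w ∈ Set.Icc (0 : ℝ) 1 := by
  induction φ with
  | var v => exact hw v
  | neg φ ih => exact ⟨sub_nonneg.2 ih.2, sub_le_self _ ih.1⟩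
  | imp φ ψ ih ih' =>
    exact ⟨le_min zero_le_one (add_nonneg (sub_nonneg.2 ih.2) ih'.1), min_le_left _ _⟩
  | nabla r φ ih =>
    have h1 := mul_nonneg r.2.1 (sub_nonneg.2 ih.2)
    have h2 := mul_le_one₀ r.2.2 (sub_nonneg.2 ih.2) (sub_le_self _ ih.1)
    exact ⟨sub_nonneg.2 h2, sub_le_self _ h1⟩

lemma eval_iff_eq_one {w : V → ℝ} {φ ψ : RieszLukForm V} (h : φ.eval w = ψ.eval w) :
    (iff φ ψ).eval w = 1 := by
  simp [iff, odot, oplus, eval, h]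

lemma IsAxiom.eval_eq_one {w : V → ℝ} (hw : ∀ v, w v ∈ Set.Icc (0 : ℝ) 1) {φ : RieszLukForm V}
    (h : IsAxiom φ) : φ.eval w = 1 := by
  have H := eval_mem_Icc hw
  cases h with
  | l1 φ ψ =>
    have h1 := H φ; have h2 := H ψ
    simp only [eval, Set.mem_Icc] at *
    grind
  | l2 φ ψ χ =>
    have h1 := H φ; have h2 := H ψ; have h3 := H χ
    simp only [eval, Set.mem_Icc] at *
    grind
  | l3 φ ψ =>
    have h1 := H φ; have h2 := H ψ
    simp only [eval, or, Set.mem_Icc] at *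
    grind
  | l4 φ ψ =>
    have h1 := H φ; have h2 := H ψ
    simp only [eval, Set.mem_Icc] at *
    grind
  | r1 r φ ψ =>
    apply eval_iff_eq_one
    have hr := r.2.1
    simp only [eval]
    rcases le_total (φ.eval w) (ψ.eval w) with h | h
    · rw [min_eq_left (by linarith), min_eq_left (by nlinarith)]
      ring
    · rw [min_eq_right (by linarith), min_eq_right (by nlinarith)]
      ring
  | r2 r q φ =>
    apply eval_iff_eq_one
    have h1 := H φ
    simp only [eval, scalarMinus, Set.mem_Icc] at *
    rcases le_total (r : ℝ) q with h | h
    · rw [max_eq_left (by linarith), min_eq_left (by nlinarith)]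
      ring
    · rw [max_eq_right (by linarith), min_eq_right (by nlinarith)]
      ring
  | r3 r q φ =>
    apply eval_iff_eq_one
    simp only [eval, Set.Icc.coe_mul]
    ring
  | r4 φ =>
    apply eval_iff_eq_one
    simp only [eval, Set.Icc.coe_one]
    ring

lemma eval_eq_one_of_imp {w : V → ℝ} (hw : ∀ v, w v ∈ Set.Icc (0 : ℝ) 1) {φ ψ : RieszLukForm V}
    (h : φ.eval w = 1) (h' : (imp φ ψ).eval w = 1) : ψ.eval w = 1 := by
  have := (eval_mem_Icc hw ψ).2
  simp only [eval, h, sub_self, zero_add, min_eq_left_iff] at h'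
  exact le_antisymm this h'

lemma Derives.eval_eq_one {w : V → ℝ} (hw : ∀ v, w v ∈ Set.Icc (0 : ℝ) 1)
    {Θ : Set (RieszLukForm V)} (hΘ : ∀ θ ∈ Θ, θ.eval w = 1) {φ : RieszLukForm V}
    (h : Derives Θ φ) : φ.eval w = 1 := by
  induction h with
  | ax h => exact h.eval_eq_one hw
  | hyp h => exact hΘ _ h
  | mp _ _ ih ih' => exact eval_eq_one_of_imp hw ih ih'

/-- Soundness along a filter: derivations are finite, so each premise need only hold eventually. -/
lemma Derives.eventually_eval_eq_one {α : Type*} {l : Filter α} {w : α → V → ℝ}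
    (hw : ∀ᶠ x in l, ∀ v, w x v ∈ Set.Icc (0 : ℝ) 1) {Θ : Set (RieszLukForm V)}
    (hΘ : ∀ θ ∈ Θ, ∀ᶠ x in l, θ.eval (w x) = 1) {φ : RieszLukForm V} (h : Derives Θ φ) :
    ∀ᶠ x in l, φ.eval (w x) = 1 := by
  induction h with
  | ax h => exact hw.mono fun x hx => h.eval_eq_one hx
  | hyp h => exact hΘ _ h
  | mp _ _ ih ih' =>
    filter_upwards [hw, ih, ih'] with x hx h h' using eval_eq_one_of_imp hx h h'

/-! ### Local behaviour of Ł-formulas at irrational points -/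

lemma int_affine_eq_zero {t : ℝ} (ht : Irrational t) {a b : ℤ} (h : a * t + b = 0) :
    a = 0 ∧ b = 0 := by
  have ha : a = 0 := by
    by_contra ha
    refine (ht.intCast_mul ha).ne_int (-b) ?_
    push_cast
    linarith
  subst ha
  exact ⟨rfl, by simpa using h⟩

/-- Pieces with integer coefficients can only meet at rational points or coincide, so an irrational
`t` is never a breakpoint. -/
lemma eventually_eval_eq_affine {t : ℝ} (ht : Irrational t) (β : LukForm V) :
    ∃ a b : ℤ, ∀ᶠ x in 𝓝 t, (β.toScalar ℝ).eval (fun _ => x) = a * x + b := by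
  induction β with
  | var v => exact ⟨1, 0, .of_forall fun x => by simp [LukForm.toScalar, eval]⟩
  | neg β ih =>
    obtain ⟨a, b, h⟩ := ih
    refine ⟨-a, 1 - b, h.mono fun x hx => ?_⟩
    simp only [LukForm.toScalar, eval, hx]
    push_cast
    ring
  | imp β γ ih ih' =>
    obtain ⟨a, b, h⟩ := ih
    obtain ⟨c, d, h'⟩ := ih'
    have hcont : ContinuousAt (fun x : ℝ => ((c - a : ℤ) : ℝ) * x + (d - b : ℤ)) t := by fun_prop
    rcases lt_trichotomy (((c - a : ℤ) : ℝ) * t + (d - b : ℤ)) 0 with hlt | heq | hgt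
    · refine ⟨c - a, 1 + d - b, ?_⟩
      filter_upwards [h, h', hcont.eventually_lt_const hlt] with x hx hx' hlt
      push_cast at hlt ⊢
      simp only [LukForm.toScalar, eval, hx, hx']
      rw [min_eq_right (by linarith)]
      ring
    · refine ⟨0, 1, ?_⟩
      obtain ⟨h1, h2⟩ := int_affine_eq_zero ht heq
      obtain rfl : c = a := by lia
      obtain rfl : d = b := by lia
      filter_upwards [h, h'] with x hx hx'
      simp [LukForm.toScalar, eval, hx, hx']
    · refine ⟨0, 1, ?_⟩
      filter_upwards [h, h', hcont.eventually_const_lt hgt] with x hx hx' hgt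
      push_cast at hgt ⊢
      simp only [LukForm.toScalar, eval, hx, hx']
      rw [min_eq_left (by linarith)]
      ring

lemma eventually_eval_eq_one {t : ℝ} (ht : Irrational t) {β : LukForm V}
    (h : (β.toScalar ℝ).eval (fun _ => t) = 1) :
    ∀ᶠ x in 𝓝 t, (β.toScalar ℝ).eval (fun _ => x) = 1 := by
  obtain ⟨a, b, hab⟩ := eventually_eval_eq_affine ht β
  have h1 := hab.self_of_nhds
  rw [h] at h1
  obtain ⟨rfl, hb⟩ := int_affine_eq_zero ht (a := a) (b := b - 1) (by push_cast; linarith)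
  obtain rfl : b = 1 := by lia
  simpa using hab

lemma eval_irrationalExample (v : V) (w : V → ℝ) :
    (irrationalExample v).eval w = min 1 (√2 * w v) := by
  simp only [irrationalExample, oplus, delta, eval, sqrtTwoDivTwo]
  congr 1
  ring

lemma not_isLukGenerated_irrationalExample (v : V) :
    ¬ IsLukGenerated (Thm {irrationalExample v}) := by
  rintro ⟨Θ, hΘ⟩
  have hsq : √2 * √2 = 2 := Real.mul_self_sqrt (by norm_num)
  have hpos : 0 < √2 := by positivity
  set t : ℝ := √2 / 2 with ht_def
  have ht : Irrational t := by
    simpa using irrational_sqrt_two.div_natCast (m := 2) two_ne_zero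
  have ht0 : 0 < t := by positivity
  have ht1 : t < 1 := by nlinarith
  -- The neighbourhood may depend on the premise; no uniformity over `Θ` is needed.
  have hloc : ∀ θ ∈ LukForm.toScalar ℝ '' Θ, ∀ᶠ x in 𝓝 t, θ.eval (fun _ : V => x) = 1 := by
    rintro _ ⟨θ, hθ, rfl⟩
    refine eventually_eval_eq_one ht ?_
    have h1 : θ.toScalar ℝ ∈ Thm {irrationalExample v} := by
      rw [hΘ]
      exact Derives.hyp ⟨θ, hθ, rfl⟩
    refine Derives.eval_eq_one (fun _ => ⟨ht0.le, ht1.le⟩) ?_ h1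
    rintro _ rfl
    rw [eval_irrationalExample, min_eq_left]
    rw [ht_def]
    linarith
  have h2 : irrationalExample v ∈ Thm (LukForm.toScalar ℝ '' Θ) := by
    rw [← hΘ]
    exact Derives.hyp rfl
  have hw : ∀ᶠ x in 𝓝 t, ∀ _ : V, x ∈ Set.Icc (0 : ℝ) 1 :=
    (Icc_mem_nhds ht0 ht1 : Set.Icc 0 1 ∈ 𝓝 t) |> Filter.Eventually.mono <| fun x hx _ => hx
  have h3 := Derives.eventually_eval_eq_one (w := fun x _ => x) hw hloc h2
  -- Pick a point just left of `t` where the example would still take the value `1`, forcing `√2 x ≥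
  -- 1`.
  obtain ⟨x, hx, hxt⟩ := ((h3.filter_mono nhdsWithin_le_nhds).and
    (self_mem_nhdsWithin : Set.Iio t ∈ 𝓝[<] t)).exists
  rw [eval_irrationalExample, min_eq_left_iff] at hx
  have hxt' : x < √2 / 2 := hxt
  nlinarith

end ScalarForm

theorem mainTheorem11 {V : Type*} :
    (∀ φ : RatLukForm V, ∃ β : LukForm V,
        ScalarForm.Thm {φ} = ScalarForm.Thm {β.toScalar ℚ}) ∧
    (∀ T : Set (RatLukForm V), ScalarForm.IsTheory T → ScalarForm.IsLukGenerated T) ∧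
    (∀ v : V, ¬ ScalarForm.IsLukGenerated (ScalarForm.Thm {irrationalExample v})) := by
  refine ⟨fun φ => ?_, fun T hT => ScalarForm.isLukGenerated_of_isTheory hT,
    ScalarForm.not_isLukGenerated_irrationalExample⟩
  obtain ⟨β, h, h'⟩ := ScalarForm.exists_lukForm_interderivable φ
  exact ⟨β, ScalarForm.Thm_eq_Thm (by rintro _ rfl; exact h') (by rintro _ rfl; exact h)⟩
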